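/- Let $0\le k\le n$. Every polynomial $p\in\mathbb{R}[x_1,\ldots,x_n]$ can be written uniquely as $p=\sum_{\mu}\mu\,p_{\mu}$, where $\mu$ ranges over the monomials in $x_1,\ldots,x_k$ and $p_{\mu}\in\mathbb{R}[x_{k+1},\ldots,x_n]$. Let $\|p\|$ denote the square root of the sum of the squares of the coefficients of $p$. A homogeneous polynomial $p$ of degree $d$ is called *$\varepsilon$-concentrated on the first $k$ variables* if $$\sum_{\mu:\ \deg(\mu)<d}\ \max_{x\in\mathbb{R}^{n-k},\ \|x\|=1}p_{\mu}(x)^2\ \le\ \varepsilon\|p\|^2,$$ where the norm on $\mathbb{R}^{n-k}$ is the Euclidean norm and the maximum over the empty set (the case $k=n$) is $0$. **Theorem.** For each real $\varepsilon>0$ and each $d\in\mathbb{N}$ there exists $k_{d,\varepsilon}\in\mathbb{N}$ such that for each $n$ and each homogeneous polynomial $p\in\mathbb{R}[x_1,\ldots,x_n]$ of degree $d$, there exist an orthogonal matrix $U\in O(n)$ and an integer $k$ with $0\le k\le n$ and $k\le k_{d,\varepsilon}$ such that the polynomial $p(Ux)$ is $\varepsilon$-concentrated on the first $k$ variables. 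-/

import Mathlib

namespace PolyConc

/-- The indices of the first `k` of the `n` variables. -/
abbrev FirstVars (n k : ℕ) : Type := {i : Fin n // i.val < k}

/-- The indices of the remaining variables. -/
abbrev LastVars (n k : ℕ) : Type := {i : Fin n // ¬ i.val < k}

/-- The composition `p ∘ U`: the polynomial obtained from `p` by the linear substitution
`x_i ↦ ∑ j, U i j * x_j`. -/
noncomputable def linSubst {n : ℕ} (U : Matrix (Fin n) (Fin n) ℝ)
    (p : MvPolynomial (Fin n) ℝ) : MvPolynomial (Fin n) ℝ :=
  MvPolynomial.aeval (fun i => ∑ j, MvPolynomial.C (U i j) * MvPolynomial.X j) p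

/-- The square root of the sum of the squares of the coefficients of `p`. -/
noncomputable def coeffNorm {n : ℕ} (p : MvPolynomial (Fin n) ℝ) : ℝ :=
  Real.sqrt (∑ m ∈ p.support, p.coeff m ^ 2)

/-- The polynomial `p_μ` in the last `n - k` variables, where `p = ∑ μ, μ * p_μ` and `μ` ranges
over the monomials (given by their exponents) in the first `k` variables. -/
noncomputable def partCoeff {n : ℕ} (k : ℕ) (p : MvPolynomial (Fin n) ℝ)
    (μ : FirstVars n k →₀ ℕ) : MvPolynomial (LastVars n k) ℝ :=
  (MvPolynomial.sumAlgEquiv ℝ (FirstVars n k) (LastVars n k)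
    (MvPolynomial.rename (Equiv.sumCompl (fun i : Fin n => i.val < k)).symm p)).coeff μ

/-- The maximum of `q(x)^2` over the Euclidean unit sphere. It is the value `0` if there are no
variables, when the unit sphere is empty. -/
noncomputable def sphereMaxSq {ι : Type} [Fintype ι] (q : MvPolynomial ι ℝ) : ℝ :=
  ⨆ x : Metric.sphere (0 : EuclideanSpace ℝ ι) 1,
    (MvPolynomial.eval (fun i => (x : EuclideanSpace ℝ ι) i) q) ^ 2

/-- A polynomial `p`, homogeneous of degree `d`, is `ε`-concentrated on the first `k` variables.
The double sum runs over all monomials `μ` of degree `j < d` in the first `k` variables. -/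
def IsConcentrated {n : ℕ} (ε : ℝ) (d k : ℕ) (p : MvPolynomial (Fin n) ℝ) : Prop :=
  ∑ j ∈ Finset.range d,
      ∑ μ ∈ Finset.finsuppAntidiag (Finset.univ : Finset (FirstVars n k)) j,
        sphereMaxSq (partCoeff k p μ)
    ≤ ε * coeffNorm p ^ 2

end PolyConc

/-! View p as a symmetric array T, on which orthogonal substitutions act slot by slot, and run an
energy increment. The energy of the first k coordinates never exceeds `normSq T`. If concentration
fails, choose for each μ a unit maximizer x_μ of p_μ². Filling each slot with a basis vector e_j
among the first k, or with x_μ, gives orthonormal elementary tensors. Those built from the e_j alone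
account for the energy (`energy_add_le`); the others carry more than ε/(d+1)^d · `normSq T`
(`sum_sphere_le`). Rotating the span of all slot vectors into the first coordinates therefore gains
that much energy (`exists_energy_increment`). About (d+1)^d/ε rounds suffice, and iterating k ↦
(k+1)^d·d bounds k independently of n (`exists_concentrated_of_energy`). -/

namespace PolyConc

open Finset MvPolynomial

/-! ### Arrays, Bessel's inequality and orthogonal substitutions. -/

section Arrays

variable {d n : ℕ}

/-- The pairing of an array with the elementary tensor `v 0 ⊗ ⋯ ⊗ v (d - 1)`. -/
def pairing (T : (Fin d → Fin n) → ℝ) (v : Fin d → Fin n → ℝ) : ℝ :=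
  ∑ f, T f * ∏ i, v i (f i)

/-- The array obtained by applying the transpose of `A` in every slot. -/
def actOn (T : (Fin d → Fin n) → ℝ) (A : Matrix (Fin n) (Fin n) ℝ) (f : Fin d → Fin n) : ℝ :=
  pairing T fun i j => A j (f i)

/-- The squared Euclidean norm of an array. -/
def normSq (T : (Fin d → Fin n) → ℝ) : ℝ := ∑ f, T f ^ 2

/-- The squared norm of the part of an array that involves only the first `k` indices. -/
def energy (T : (Fin d → Fin n) → ℝ) (k : ℕ) : ℝ :=
  ∑ f with ∀ i, (f i).val < k, T f ^ 2

/-- An array is symmetric if its entries are invariant under permutations of the slots. -/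
def IsSymmArray (T : (Fin d → Fin n) → ℝ) : Prop :=
  ∀ (e : Equiv.Perm (Fin d)) (f : Fin d → Fin n), T (f ∘ e) = T f

/-- The homogeneous polynomial `∑ f, T f * ∏ i, X (f i)`. -/
noncomputable def ofArray (T : (Fin d → Fin n) → ℝ) : MvPolynomial (Fin n) ℝ :=
  ∑ f, C (T f) * ∏ i, X (f i)

/-- The exponent of the monomial `∏ i, X (f i)`. -/
noncomputable def expOf {σ : Type*} (f : Fin d → σ) : σ →₀ ℕ := ∑ i, Finsupp.single (f i) 1

theorem normSq_nonneg (T : (Fin d → Fin n) → ℝ) : 0 ≤ normSq T :=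
  sum_nonneg fun _ _ => sq_nonneg _

theorem energy_nonneg (T : (Fin d → Fin n) → ℝ) (k : ℕ) : 0 ≤ energy T k :=
  sum_nonneg fun _ _ => sq_nonneg _

theorem energy_le_normSq (T : (Fin d → Fin n) → ℝ) (k : ℕ) : energy T k ≤ normSq T :=
  sum_le_sum_of_subset_of_nonneg (filter_subset _ _) fun _ _ _ => sq_nonneg _

theorem sum_prod_apply (v : Fin d → Fin n → ℝ) :
    ∑ f : Fin d → Fin n, ∏ i, v i (f i) = ∏ i, ∑ j, v i j := by
  rw [Finset.prod_univ_sum, Fintype.piFinset_univ]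

theorem pairing_actOn (T : (Fin d → Fin n) → ℝ) (A : Matrix (Fin n) (Fin n) ℝ)
    (v : Fin d → Fin n → ℝ) : pairing (actOn T A) v = pairing T fun i => A.mulVec (v i) := by
  simp only [pairing, actOn, sum_mul]
  rw [sum_comm]
  refine sum_congr rfl fun g _ => ?_
  simp only [mul_assoc, ← prod_mul_distrib, ← mul_sum]
  rw [sum_prod_apply fun i j => A (g i) j * v i j]
  rfl

/-- Bessel's inequality for a finite orthonormal family. -/
theorem bessel {ι Φ : Type*} [Fintype ι] [Fintype Φ] [DecidableEq ι] (S : Φ → ℝ) (t : ι → Φ → ℝ)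
    (ht : ∀ a b, ∑ f, t a f * t b f = if a = b then 1 else 0) :
    ∑ a, (∑ f, S f * t a f) ^ 2 ≤ ∑ f, S f ^ 2 := by
  have h := Orthonormal.sum_inner_products_le (𝕜 := ℝ) (WithLp.toLp 2 S : EuclideanSpace ℝ Φ)
    (v := fun a => (WithLp.toLp 2 (t a) : EuclideanSpace ℝ Φ)) (s := univ) (by
      rw [orthonormal_iff_ite]
      intro a b
      rw [← ht a b]
      simp [PiLp.inner_apply, mul_comm])
  simpa [PiLp.inner_apply, EuclideanSpace.norm_sq_eq] using h

theorem sum_sq_pairing_le {ι : Type*} [Fintype ι] [DecidableEq ι] (T : (Fin d → Fin n) → ℝ)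
    (v : ι → Fin d → Fin n → ℝ)
    (hv : ∀ a b, ∏ i, ∑ j, v a i j * v b i j = if a = b then 1 else 0) :
    ∑ a, pairing T (v a) ^ 2 ≤ normSq T := by
  refine bessel T (fun a f => ∏ i, v a i (f i)) fun a b => ?_
  simp only [← prod_mul_distrib]
  rw [sum_prod_apply fun i j => v a i j * v b i j, hv]

/-- Vectors supported on the first k coordinates do not see the other entries, so Bessel applies to
the truncated array. -/
theorem sum_sq_pairing_le_energy {ι : Type*} [Fintype ι] [DecidableEq ι]
    (T : (Fin d → Fin n) → ℝ) (k : ℕ) (v : ι → Fin d → Fin n → ℝ)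
    (hk : ∀ a i j, ¬ j.val < k → v a i j = 0)
    (hv : ∀ a b, ∏ i, ∑ j, v a i j * v b i j = if a = b then 1 else 0) :
    ∑ a, pairing T (v a) ^ 2 ≤ energy T k := by
  have h := sum_sq_pairing_le (fun f => if ∀ i, (f i).val < k then T f else 0) v hv
  have e1 : energy T k = normSq fun f => if ∀ i, (f i).val < k then T f else 0 := by
    simp [energy, normSq, sum_filter, ite_pow]
  have e2 : ∀ a, pairing T (v a) =
      pairing (fun f => if ∀ i, (f i).val < k then T f else 0) (v a) := by
    intro a
    refine sum_congr rfl fun f _ => ?_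
    dsimp only
    split_ifs with hf
    · rfl
    · push Not at hf
      obtain ⟨i, hi⟩ := hf
      rw [prod_eq_zero (mem_univ i) (hk a i _ (not_lt.2 hi)), mul_zero, mul_zero]
  rw [e1]
  simpa only [e2] using h

/-- The new entries are pairings with tensor products of columns of `U`, an orthonormal family. -/
theorem normSq_actOn_le (T : (Fin d → Fin n) → ℝ) {U : Matrix (Fin n) (Fin n) ℝ}
    (hU : U ∈ Matrix.orthogonalGroup (Fin n) ℝ) : normSq (actOn T U) ≤ normSq T := by
  have key := sum_sq_pairing_le T (fun (f : Fin d → Fin n) i j => U j (f i))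
  refine key fun f g => ?_
  have hU' : U.transpose * U = 1 := (Matrix.mem_orthogonalGroup_iff' _ _).1 hU
  have h : ∀ a b, ∑ j, U j a * U j b = if a = b then 1 else 0 := fun a b => by
    rw [← Matrix.one_apply, ← hU']; rfl
  simp only [h]
  split_ifs with hfg
  · simp [hfg]
  · obtain ⟨i, hi⟩ := Function.ne_iff.1 hfg
    exact prod_eq_zero (mem_univ i) (if_neg hi)

theorem IsSymmArray.actOn {T : (Fin d → Fin n) → ℝ} (hT : IsSymmArray T)
    (A : Matrix (Fin n) (Fin n) ℝ) : IsSymmArray (actOn T A) := by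
  intro e f
  simp only [PolyConc.actOn, pairing]
  rw [← Equiv.sum_comp (Equiv.arrowCongr e.symm (Equiv.refl (Fin n)))]
  refine sum_congr rfl fun g _ => ?_
  have : (Equiv.arrowCongr e.symm (Equiv.refl (Fin n))) g = g ∘ e := by
    ext; simp [Equiv.arrowCongr]
  rw [this, hT e g]
  congr 1
  exact Equiv.prod_comp e fun i => A (g i) (f i)

theorem linSubst_ofArray (T : (Fin d → Fin n) → ℝ) (A : Matrix (Fin n) (Fin n) ℝ) :
    linSubst A (ofArray T) = ofArray (actOn T A) := by
  simp only [linSubst, ofArray, actOn, pairing, map_sum, map_mul, map_prod, aeval_X, sum_mul]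
  rw [sum_comm]
  refine sum_congr rfl fun f _ => ?_
  rw [Finset.prod_univ_sum, Fintype.piFinset_univ, mul_sum]
  refine sum_congr rfl fun g _ => ?_
  rw [prod_mul_distrib, mul_assoc]
  simp [MvPolynomial.algebraMap_eq]

theorem linSubst_linSubst (A B : Matrix (Fin n) (Fin n) ℝ) (p : MvPolynomial (Fin n) ℝ) :
    linSubst B (linSubst A p) = linSubst (A * B) p := by
  simp only [linSubst, ← AlgHom.comp_apply]
  congr 1
  ext1 i
  simp only [AlgHom.comp_apply, aeval_X, map_sum, map_mul, Matrix.mul_apply, sum_mul, mul_sum]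
  rw [sum_comm]
  simp [MvPolynomial.algebraMap_eq, mul_assoc]

/-! ### Homogeneous polynomials versus symmetric arrays. -/

theorem prod_X_eq_monomial_expOf {σ R : Type*} [CommSemiring R] (f : Fin d → σ) :
    (∏ i, X (f i) : MvPolynomial σ R) = monomial (expOf f) 1 := by
  simp [expOf, monomial_sum_one, X]

theorem degree_expOf {σ : Type*} (f : Fin d → σ) : (expOf f).degree = d := by
  simp [expOf, map_sum]

theorem exists_perm_of_expOf_eq {σ : Type*} {f g : Fin d → σ} (h : expOf f = expOf g) :
    ∃ e : Equiv.Perm (Fin d), f = g ∘ e := by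
  classical
  -- The exponent at `c` counts the fibre over `c`, so the fibres can be matched one by one.
  have hc : ∀ c, Nonempty ({i // f i = c} ≃ {i // g i = c}) := by
    intro c
    refine Fintype.card_eq.1 ?_
    have := DFunLike.congr_fun h c
    simpa [expOf, Finsupp.single_apply, Finsupp.finsetSum_apply, Fintype.card_subtype] using this
  exact ⟨Equiv.ofFiberEquiv fun c => (hc c).some, funext fun i =>
    (Equiv.ofFiberEquiv_map _ i).symm⟩

theorem exists_expOf_eq {σ : Type*} {m : σ →₀ ℕ} (hm : m.degree = d) :
    ∃ f : Fin d → σ, expOf f = m := by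
  classical
  obtain ⟨l, hl⟩ := Quot.exists_rep (Finsupp.toMultiset m)
  have hl : (l : Multiset σ) = Finsupp.toMultiset m := hl
  have hlen : l.length = d := by
    rw [← hm, ← Multiset.coe_card, hl, Finsupp.card_toMultiset]; rfl
  subst hlen
  refine ⟨l.get, Multiset.toFinsupp.symm.injective ?_⟩
  calc Finsupp.toMultiset (expOf l.get) = ((univ.val.map l.get).map singleton).sum := by
        rw [expOf, map_sum, Multiset.map_map]
        exact sum_congr rfl fun i _ => by simp
    _ = l := by rw [Multiset.sum_map_singleton, Fin.univ_val_map, List.ofFn_get]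
    _ = Finsupp.toMultiset m := hl

theorem coeff_ofArray (T : (Fin d → Fin n) → ℝ) (m : Fin n →₀ ℕ) :
    (ofArray T).coeff m = ∑ f with expOf f = m, T f := by
  simp only [ofArray, coeff_sum, prod_X_eq_monomial_expOf, coeff_C_mul, coeff_monomial,
    mul_ite, mul_one, mul_zero, sum_filter]

theorem exists_symmArray {p : MvPolynomial (Fin n) ℝ} (hp : p.IsHomogeneous d) :
    ∃ T : (Fin d → Fin n) → ℝ, IsSymmArray T ∧ ofArray T = p := by
  classical
  refine ⟨fun f => p.coeff (expOf f) / #{g : Fin d → Fin n | expOf g = expOf f}, ?_, ?_⟩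
  · intro e f
    have : expOf (f ∘ e) = expOf f := Equiv.sum_comp e fun i => Finsupp.single (f i) 1
    simp only [this]
  · ext m
    rw [coeff_ofArray]
    by_cases hm : m.degree = d
    · obtain ⟨f, hf⟩ := exists_expOf_eq hm
      have h0 : (#{g : Fin d → Fin n | expOf g = m} : ℝ) ≠ 0 := by
        exact_mod_cast (card_pos.2 ⟨f, by simpa using hf⟩).ne'
      rw [sum_congr rfl (g := fun _ => p.coeff m / #{g : Fin d → Fin n | expOf g = m})
        fun g hg => by rw [(mem_filter.1 hg).2], sum_const, nsmul_eq_mul]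
      field_simp
    · rw [hp.coeff_eq_zero hm, filter_false_of_mem, sum_empty]
      rintro f - rfl
      exact hm (degree_expOf f)

/-- If c ≥ 1 tuples share an exponent, their common entry t contributes c·t² on the left and (c·t)²
on the right. -/
theorem normSq_le_coeffNorm_sq {T : (Fin d → Fin n) → ℝ} (hT : IsSymmArray T) :
    normSq T ≤ coeffNorm (ofArray T) ^ 2 := by
  classical
  rw [coeffNorm, Real.sq_sqrt (sum_nonneg fun _ _ => sq_nonneg _)]
  have key : ∀ m, ∑ f with expOf f = m, T f ^ 2 ≤ (ofArray T).coeff m ^ 2 := by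
    intro m
    rw [coeff_ofArray]
    rcases Finset.eq_empty_or_nonempty {f : Fin d → Fin n | expOf f = m} with h | ⟨g, hg⟩
    · simp [h]
    · have hc : ∀ f ∈ ({f : Fin d → Fin n | expOf f = m} : Finset _), T f = T g := by
        intro f hf
        obtain ⟨e, rfl⟩ := exists_perm_of_expOf_eq
          ((mem_filter.1 hf).2.trans (mem_filter.1 hg).2.symm)
        exact hT e g
      rw [sum_congr rfl hc, sum_congr rfl fun f hf => by rw [hc f hf], sum_const, sum_const,
        nsmul_eq_mul, nsmul_eq_mul, mul_pow]
      have h1 : (1 : ℝ) ≤ #{f : Fin d → Fin n | expOf f = m} := by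
        exact_mod_cast card_pos.2 ⟨g, hg⟩
      exact mul_le_mul_of_nonneg_right (by nlinarith) (sq_nonneg _)
  calc normSq T = ∑ m ∈ univ.image (expOf : (Fin d → Fin n) → _),
        ∑ f with expOf f = m, T f ^ 2 :=
        (sum_fiberwise_of_maps_to (fun f _ => mem_image_of_mem _ (mem_univ f)) _).symm
    _ ≤ ∑ m ∈ univ.image (expOf : (Fin d → Fin n) → _), (ofArray T).coeff m ^ 2 :=
        sum_le_sum fun m _ => key m
    _ ≤ ∑ m ∈ (ofArray T).support, (ofArray T).coeff m ^ 2 := by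
        rw [← sum_filter_of_ne (p := fun m => (ofArray T).coeff m ≠ 0)
          fun m _ h h0 => h (by simp [h0])]
        exact sum_le_sum_of_subset_of_nonneg
          (fun m hm => mem_support_iff.2 (mem_filter.1 hm).2) fun _ _ _ => sq_nonneg _

end Arrays

/-! ### Patterns: expanding p_μ(x) over elementary tensors. -/

section Patterns

variable {d n k : ℕ}

/-- A vector in the last `n - k` coordinates, extended by zero. -/
def extendLast (x : LastVars n k → ℝ) (j : Fin n) : ℝ :=
  if h : j.val < k then 0 else x ⟨j, h⟩

/-- The standard basis vector for `some j`, and the extension of `x` by zero for `none`. -/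
def slotVector (x : LastVars n k → ℝ) : Option (FirstVars n k) → Fin n → ℝ
  | none => extendLast x
  | some j => Pi.single j.1 1

/-- Which of the indices `f i` are among the first `k`, and their values. -/
def patternOf (f : Fin d → Fin n) (i : Fin d) : Option (FirstVars n k) :=
  if h : (f i).val < k then some ⟨f i, h⟩ else none

/-- The exponent of the monomial in the first `k` variables prescribed by a pattern. -/
noncomputable def patternExp (α : Fin d → Option (FirstVars n k)) : FirstVars n k →₀ ℕ :=
  ∑ i, (α i).elim 0 fun j => Finsupp.single j 1

theorem prod_slotVector (x : LastVars n k → ℝ) (α : Fin d → Option (FirstVars n k))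
    (f : Fin d → Fin n) (h : α ≠ patternOf f) : ∏ i, slotVector x (α i) (f i) = 0 := by
  obtain ⟨i, hi⟩ := Function.ne_iff.1 h
  refine prod_eq_zero (mem_univ i) ?_
  unfold patternOf at hi
  cases hα : α i with
  | none =>
    rw [hα] at hi
    by_cases hf : (f i).val < k
    · simp [slotVector, extendLast, hf]
    · simp [hf] at hi
  | some j =>
    rw [hα] at hi
    refine Pi.single_eq_of_ne (fun hj => hi ?_) _
    simp [hj, j.2]

theorem sumAlgEquiv_rename_prod_X (f : Fin d → Fin n) :
    sumAlgEquiv ℝ (FirstVars n k) (LastVars n k)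
      (rename (Equiv.sumCompl fun i : Fin n => i.val < k).symm (∏ i, X (f i))) =
    monomial (patternExp (patternOf f))
      (∏ i, if h : (f i).val < k then 1 else X ⟨f i, h⟩) := by
  have h : ∀ i, sumAlgEquiv ℝ (FirstVars n k) (LastVars n k)
      (rename (Equiv.sumCompl fun i : Fin n => i.val < k).symm (X (f i))) =
      monomial ((patternOf f i : Option (FirstVars n k)).elim 0 fun j => Finsupp.single j 1)
        (if h : (f i).val < k then 1 else X ⟨f i, h⟩) := by
    intro i
    rw [rename_X]
    by_cases hi : (f i).val < k
    · rw [Equiv.sumCompl_symm_apply_of_pos (p := fun i : Fin n => i.val < k) hi, sumAlgEquiv_X_inl]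
      simp [patternOf, hi, X]
    · rw [Equiv.sumCompl_symm_apply_of_neg (p := fun i : Fin n => i.val < k) hi, sumAlgEquiv_X_inr]
      simp [patternOf, hi]
  rw [map_prod, map_prod]
  simp only [h]
  rw [patternExp, monomial_sum_prod]

/-- Multilinear expansion: for each `f` only its own pattern pairs nontrivially, and p_μ collects
the patterns whose basis vectors multiply to μ. -/
theorem eval_partCoeff_ofArray (T : (Fin d → Fin n) → ℝ) (μ : FirstVars n k →₀ ℕ)
    (x : LastVars n k → ℝ) :
    eval x (partCoeff k (ofArray T) μ) =
      ∑ α with patternExp α = μ, pairing T fun i => slotVector x (α i) := by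
  classical
  have h1 : ∀ f : Fin d → Fin n, ∏ i, slotVector x (patternOf f i) (f i) =
      eval x (∏ i, if h : (f i).val < k then 1 else X ⟨f i, h⟩) := by
    intro f
    rw [map_prod]
    refine prod_congr rfl fun i _ => ?_
    by_cases hi : (f i).val < k <;> simp [patternOf, hi, slotVector, extendLast]
  have h2 : ∀ f : Fin d → Fin n,
      ∑ α with patternExp α = μ, ∏ i, slotVector x (α i) (f i) =
        if patternExp (patternOf f) = μ then
          eval x (∏ i, if h : (f i).val < k then 1 else X ⟨f i, h⟩) else 0 := by
    intro f
    rw [sum_filter, sum_eq_single (patternOf f), h1]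
    · intro α _ hα
      rw [prod_slotVector x α f hα, ite_self]
    · simp
  simp only [pairing]
  rw [sum_comm]
  simp only [← mul_sum, h2]
  simp only [partCoeff, ofArray, map_sum, map_mul, sumAlgEquiv_rename_prod_X, rename_C,
    sumAlgEquiv_C_inl, coeff_sum, coeff_C_mul, coeff_monomial]
  refine sum_congr rfl fun f _ => ?_
  split_ifs <;> simp

theorem sum_patternExp (α : Fin d → Option (FirstVars n k)) :
    ∑ j, patternExp α j = #{i | (α i).isSome} := by
  simp only [patternExp, Finsupp.finsetSum_apply]
  rw [sum_comm, card_filter]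
  refine sum_congr rfl fun i _ => ?_
  cases α i <;> simp [Finsupp.single_apply]

/-- Each slot holds `none` or one of the at most d variables of μ. The bound is free of n and k,
which keeps the energy gain uniform. -/
theorem card_patternExp_eq_le (μ : FirstVars n k →₀ ℕ) (hμ : ∑ j, μ j ≤ d) :
    #{α : Fin d → Option (FirstVars n k) | patternExp α = μ} ≤ (d + 1) ^ d := by
  classical
  calc _ ≤ #(Fintype.piFinset fun _ : Fin d => insertNone μ.support) := by
        refine card_le_card fun α hα => ?_
        obtain rfl := (mem_filter.1 hα).2
        rw [Fintype.mem_piFinset]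
        intro i
        rw [mem_insertNone]
        intro a ha
        have ha : α i = some a := ha
        rw [Finsupp.mem_support_iff, patternExp, Finsupp.finsetSum_apply]
        refine (lt_of_lt_of_le ?_ (single_le_sum (fun _ _ => Nat.zero_le _) (mem_univ i))).ne'
        simp [ha]
    _ = (#μ.support + 1) ^ d := by simp
    _ ≤ (d + 1) ^ d := by
        refine Nat.pow_le_pow_left (Nat.succ_le_succ (le_trans ?_ hμ)) d
        rw [card_eq_sum_ones]
        refine (sum_le_sum fun j hj => ?_).trans
          (sum_le_sum_of_subset (f := fun j => μ j) (subset_univ μ.support))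
        exact Nat.one_le_iff_ne_zero.2 (Finsupp.mem_support_iff.1 hj)

theorem sum_slotVector_mul (x y : LastVars n k → ℝ) (o o' : Option (FirstVars n k)) (h : o ≠ o') :
    ∑ j, slotVector x o j * slotVector y o' j = 0 := by
  refine sum_eq_zero fun j _ => ?_
  cases o with
  | none =>
    cases o' with
    | none => exact absurd rfl h
    | some b =>
      by_cases hj : j.val < k
      · simp [slotVector, extendLast, hj]
      · rw [show slotVector y (some b) j = 0 from
          Pi.single_eq_of_ne (fun hb : j = b.1 => hj (hb ▸ b.2)) _, mul_zero]
  | some a =>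
    cases o' with
    | none =>
      by_cases hj : j.val < k
      · simp [slotVector, extendLast, hj]
      · rw [show slotVector x (some a) j = 0 from
          Pi.single_eq_of_ne (fun hb : j = a.1 => hj (hb ▸ a.2)) _, zero_mul]
    | some b =>
      by_cases hj : j = a.1
      · rw [show slotVector y (some b) j = 0 from Pi.single_eq_of_ne
          (fun hb => h (congrArg some (Subtype.ext (hj.symm.trans hb)))) _, mul_zero]
      · rw [show slotVector x (some a) j = 0 from Pi.single_eq_of_ne hj _, zero_mul]

theorem sum_slotVector_sq {x : LastVars n k → ℝ} (hx : ∑ j, x j ^ 2 = 1)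
    (o : Option (FirstVars n k)) : ∑ j, slotVector x o j * slotVector x o j = 1 := by
  cases o with
  | none =>
    rw [← hx, ← Fintype.sum_subtype_add_sum_subtype (fun j : Fin n => j.val < k)]
    simp only [slotVector, extendLast]
    rw [sum_eq_zero fun j _ => by simp [j.2], zero_add]
    exact sum_congr rfl fun j _ => by simp [j.2, sq]
  | some j => simp [slotVector, Pi.single_apply]

/-- The vectors attached to a pattern, given a choice of a vector for each exponent. -/
noncomputable def patternVectors (x : (FirstVars n k →₀ ℕ) → LastVars n k → ℝ)
    (α : Fin d → Option (FirstVars n k)) (i : Fin d) : Fin n → ℝ :=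
  slotVector (x (patternExp α)) (α i)

/-- The vector x varies with the pattern, but in a slot where two patterns differ at least one holds
a basis vector, so orthogonality there does not depend on x. -/
theorem patternVectors_orthonormal {x : (FirstVars n k →₀ ℕ) → LastVars n k → ℝ}
    (hx : ∀ μ, ∑ j, x μ j ^ 2 = 1) (α β : Fin d → Option (FirstVars n k)) :
    ∏ i, ∑ j, patternVectors x α i j * patternVectors x β i j = if α = β then 1 else 0 := by
  split_ifs with h
  · subst h
    exact prod_eq_one fun i _ => sum_slotVector_sq (hx _) _
  · obtain ⟨i, hi⟩ := Function.ne_iff.1 h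
    exact prod_eq_zero (mem_univ i) (sum_slotVector_mul _ _ _ _ hi)

/-- A pattern without `none` pairs with `T` to give a single entry; such patterns have degree d,
hence are disjoint from those in the second sum. -/
theorem energy_add_le (T : (Fin d → Fin n) → ℝ)
    (x : (FirstVars n k →₀ ℕ) → LastVars n k → ℝ) :
    energy T k + ∑ α with ∑ j, patternExp α j < d,
        pairing T (patternVectors x α) ^ 2 ≤
      ∑ α, pairing T (patternVectors x α) ^ 2 := by
  classical
  rw [← sum_filter_not_add_sum_filter univ
    (fun α : Fin d → Option (FirstVars n k) => ∑ j, patternExp α j < d)]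
  gcongr
  have hp : ∀ f ∈ ({f | ∀ i, (f i).val < k} : Finset (Fin d → Fin n)),
      T f = pairing T (patternVectors x (patternOf f)) := by
    intro f hf
    have hf := (mem_filter.1 hf).2
    have e : ∀ i, patternOf (k := k) f i = some ⟨f i, hf i⟩ := fun i => dif_pos (hf i)
    simp only [pairing, patternVectors, e, slotVector]
    rw [sum_eq_single f, prod_eq_one, mul_one]
    · intro i _; simp
    · intro g _ hg
      obtain ⟨i, hi⟩ := Function.ne_iff.1 hg
      rw [prod_eq_zero (mem_univ i) (Pi.single_eq_of_ne hi _), mul_zero]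
    · simp
  rw [energy, sum_congr rfl fun f hf => by rw [hp f hf]]
  rw [← sum_image (f := fun α => pairing T (patternVectors x α) ^ 2)
    (g := patternOf (k := k)) (s := {f : Fin d → Fin n | ∀ i, (f i).val < k})]
  · refine sum_le_sum_of_subset_of_nonneg (fun α hα => ?_) fun _ _ _ => sq_nonneg _
    obtain ⟨f, hf, rfl⟩ := mem_image.1 hα
    have hf := (mem_filter.1 hf).2
    rw [mem_filter, sum_patternExp]
    simp [patternOf, hf]
  · intro f hf g hg h
    have hf := (mem_filter.1 hf).2
    have hg := (mem_filter.1 hg).2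
    funext i
    have := congrFun h i
    simpa [patternOf, hf i, hg i] using this

/-- Cauchy–Schwarz over the at most (d+1)^d patterns with exponent μ. -/
theorem sum_sphere_le {F : (FirstVars n k →₀ ℕ) → ℝ} (T : (Fin d → Fin n) → ℝ)
    (x : (FirstVars n k →₀ ℕ) → LastVars n k → ℝ)
    (hF : ∀ μ, F μ ≤ eval (x μ) (partCoeff k (ofArray T) μ) ^ 2) :
    ∑ j ∈ range d, ∑ μ ∈ finsuppAntidiag (univ : Finset (FirstVars n k)) j, F μ ≤
      (d + 1) ^ d * ∑ α with ∑ j, patternExp α j < d,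
        pairing T (patternVectors x α) ^ 2 := by
  classical
  have h1 : ∀ j ∈ range d, ∀ μ ∈ finsuppAntidiag (univ : Finset (FirstVars n k)) j,
      F μ ≤ (d + 1) ^ d * ∑ α : Fin d → Option (FirstVars n k),
        if patternExp α = μ then pairing T (patternVectors x α) ^ 2 else 0 := by
    intro j hj μ hμ
    have hj := mem_range.1 hj
    have hμ : ∑ a, μ a = j := (mem_finsuppAntidiag.1 hμ).1
    refine (hF μ).trans ?_
    rw [eval_partCoeff_ofArray]
    refine sq_sum_le_card_mul_sum_sq.trans ?_
    have e : ∑ α : Fin d → Option (FirstVars n k) with patternExp α = μ,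
        (pairing T fun i => slotVector (x μ) (α i)) ^ 2 =
        ∑ α : Fin d → Option (FirstVars n k),
        if patternExp α = μ then pairing T (patternVectors x α) ^ 2 else 0 := by
      rw [sum_filter]
      refine sum_congr rfl fun α _ => ?_
      split_ifs with h
      · subst h; rfl
      · rfl
    rw [e]
    refine mul_le_mul_of_nonneg_right ?_ (sum_nonneg fun α _ => by positivity)
    exact_mod_cast card_patternExp_eq_le μ (by omega)
  refine (sum_le_sum fun j hj => sum_le_sum (h1 j hj)).trans (le_of_eq ?_)
  simp only [← mul_sum]
  congr 1
  -- Each pattern of degree below d is counted for exactly one pair (j, μ).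
  rw [sum_congr rfl fun j _ => sum_comm, sum_comm, sum_filter]
  refine sum_congr rfl fun α _ => ?_
  simp [mem_finsuppAntidiag]

end Patterns

/-! ### The energy increment and its iteration. -/

section Concentration

variable {d n k : ℕ}

/-- Finitely many vectors can be moved by an orthogonal matrix into the first coordinates. -/
theorem exists_orthogonal_adapted {ι : Type*} [Fintype ι] (w : ι → Fin n → ℝ) :
    ∃ U ∈ Matrix.orthogonalGroup (Fin n) ℝ, ∃ k ≤ n, k ≤ Fintype.card ι ∧
      ∀ a (j : Fin n), ¬ j.val < k → U.transpose.mulVec (w a) j = 0 := by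
  classical
  let w' : ι → EuclideanSpace ℝ (Fin n) := fun a => WithLp.toLp 2 (w a)
  let W : Submodule ℝ (EuclideanSpace ℝ (Fin n)) := Submodule.span ℝ (Set.range w')
  have hWn : Module.finrank ℝ W ≤ n := by
    simpa using Submodule.finrank_le W
  let c := stdOrthonormalBasis ℝ W
  -- The zeros are fillers: only the first `finrank W` vectors are prescribed in the extension to a
  -- basis.
  let v : Fin n → EuclideanSpace ℝ (Fin n) := fun i =>
    if h : i.val < Module.finrank ℝ W then (c ⟨i, h⟩ : EuclideanSpace ℝ (Fin n)) else 0
  have hv : Orthonormal ℝ (Set.domRestrict {i : Fin n | i.val < Module.finrank ℝ W} v) := by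
    have h := (c.orthonormal.comp_linearIsometry W.subtypeₗᵢ).comp
      (fun i : {i : Fin n | i.val < Module.finrank ℝ W} =>
        (⟨i.1, i.2⟩ : Fin (Module.finrank ℝ W)))
      (fun i j hij => Subtype.ext (Fin.ext (by simpa using hij)))
    convert h using 1
    funext i
    have hi : i.1.val < Module.finrank ℝ W := i.2
    simp [v, hi]
  obtain ⟨b, hb⟩ := hv.exists_orthonormalBasis_extension_of_card_eq (by simp)
  have hsum : ∀ i j, ∑ l, b i l * b j l = if i = j then 1 else 0 := by
    intro i j
    rw [← orthonormal_iff_ite.1 b.orthonormal i j]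
    simp [PiLp.inner_apply, mul_comm]
  refine ⟨Matrix.of fun i j => b j i, ?_, Module.finrank ℝ W, hWn, finrank_range_le_card w', ?_⟩
  · rw [Matrix.mem_orthogonalGroup_iff']
    ext i j
    rw [Matrix.mul_apply, Matrix.one_apply, ← hsum i j]
    rfl
  · intro a j hj
    have hW : ∀ y ∈ W, inner ℝ (b j) y = 0 := by
      intro y hy
      have hy' : y = ∑ i, inner ℝ (c i) (⟨y, hy⟩ : W) • (c i : EuclideanSpace ℝ (Fin n)) := by
        conv_lhs => rw [show y = ((⟨y, hy⟩ : W) : EuclideanSpace ℝ (Fin n)) from rfl,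
          ← c.sum_repr' ⟨y, hy⟩]
        simp
      rw [hy', inner_sum]
      refine sum_eq_zero fun i _ => ?_
      have hi : (i.val) < n := i.2.trans_le hWn
      have hbi : b ⟨i, hi⟩ = c i := by
        rw [hb ⟨i, hi⟩ i.2]
        simp [v]
      rw [inner_smul_right, ← hbi, b.orthonormal.2 (fun h => hj (by rw [h]; exact i.2)), mul_zero]
    have := hW (w' a) (Submodule.subset_span ⟨a, rfl⟩)
    rw [PiLp.inner_apply] at this
    rw [← this, Matrix.mulVec, dotProduct]
    refine sum_congr rfl fun l _ => ?_
    simp [w', mul_comm]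

theorem sphereMaxSq_le_eval_sq {ι : Type} [Fintype ι] [Nonempty ι] (q : MvPolynomial ι ℝ) :
    ∃ x : ι → ℝ, ∑ i, x i ^ 2 = 1 ∧ sphereMaxSq q ≤ eval x q ^ 2 := by
  classical
  have hne : (Metric.sphere (0 : EuclideanSpace ℝ ι) 1).Nonempty :=
    NormedSpace.sphere_nonempty.2 zero_le_one
  have hc : Continuous fun y : EuclideanSpace ℝ ι => eval (fun i => y i) q ^ 2 :=
    ((MvPolynomial.continuous_eval q).comp (by fun_prop)).pow 2
  obtain ⟨x, hx, hmax⟩ := (isCompact_sphere (0 : EuclideanSpace ℝ ι) 1).exists_isMaxOn hne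
    hc.continuousOn
  refine ⟨fun i => x i, ?_, ?_⟩
  · have : ‖x‖ = 1 := by simpa using hx
    rw [← EuclideanSpace.real_norm_sq_eq, this, one_pow]
  · have := hne.to_subtype
    exact ciSup_le fun y => hmax y.2

theorem sphereMaxSq_of_isEmpty {ι : Type} [Fintype ι] [IsEmpty ι] (q : MvPolynomial ι ℝ) :
    sphereMaxSq q = 0 := by
  have : IsEmpty (Metric.sphere (0 : EuclideanSpace ℝ ι) 1) :=
    ⟨fun x => by simpa [Subsingleton.elim x.1 0] using x.2⟩
  exact Real.iSup_of_isEmpty _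

theorem card_firstVars_le (n k : ℕ) : Fintype.card (FirstVars n k) ≤ k := by
  refine le_of_le_of_eq ?_ (Fintype.card_fin k)
  exact Fintype.card_le_of_injective (fun i : FirstVars n k => (⟨i.1, i.2⟩ : Fin k))
    fun i j h => Subtype.ext (Fin.ext (by simpa using h))

/-- If an array does not give a concentrated polynomial, then after an orthogonal change of
coordinates a bounded number of coordinates carries more energy. -/
theorem exists_energy_increment (T : (Fin d → Fin n) → ℝ) {ε : ℝ} (hε : 0 ≤ ε)
    (hT : IsSymmArray T) (h : ¬ IsConcentrated ε d k (ofArray T)) :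
    ∃ U ∈ Matrix.orthogonalGroup (Fin n) ℝ, ∃ k' ≤ n, k' ≤ (k + 1) ^ d * d ∧
      energy T k + ε / (d + 1) ^ d * normSq T < energy (actOn T U) k' := by
  classical
  rw [IsConcentrated, not_le] at h
  have hnorm : ε * normSq T ≤ ε * coeffNorm (ofArray T) ^ 2 :=
    mul_le_mul_of_nonneg_left (normSq_le_coeffNorm_sq hT) hε
  -- With no remaining variables all maxima are 0, so concentration cannot fail.
  rcases isEmpty_or_nonempty (LastVars n k) with hk | hk
  · simp only [sphereMaxSq_of_isEmpty, sum_const_zero] at h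
    exact absurd h (not_lt.2 ((mul_nonneg hε (normSq_nonneg T)).trans hnorm))
  choose x hx1 hx2 using fun μ : FirstVars n k →₀ ℕ =>
    sphereMaxSq_le_eval_sq (partCoeff k (ofArray T) μ)
  -- One vector per pattern and slot, whence the bound (k+1)^d·d.
  obtain ⟨U, hU, k', hk'n, hk', hsupp⟩ := exists_orthogonal_adapted
    fun a : (Fin d → Option (FirstVars n k)) × Fin d => patternVectors x a.1 a.2
  have hUU : U * U.transpose = 1 := (Matrix.mem_orthogonalGroup_iff _ _).1 hU
  refine ⟨U, hU, k', hk'n, hk'.trans ?_, ?_⟩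
  · simp only [Fintype.card_prod, Fintype.card_fun, Fintype.card_option, Fintype.card_fin]
    gcongr
    exact card_firstVars_le n k
  · have hdot : ∀ u v : Fin n → ℝ, ∑ j, U.transpose.mulVec u j * U.transpose.mulVec v j =
        ∑ j, u j * v j := by
      intro u v
      change U.transpose.mulVec u ⬝ᵥ U.transpose.mulVec v = u ⬝ᵥ v
      rw [Matrix.dotProduct_mulVec, Matrix.vecMul_transpose, Matrix.mulVec_mulVec, hUU,
        Matrix.one_mulVec]
    have hb := sum_sq_pairing_le_energy (actOn T U) k'
      (fun (α : Fin d → Option (FirstVars n k)) i => U.transpose.mulVec (patternVectors x α i))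
      (fun α i j hj => hsupp (α, i) j hj)
      (fun α β => by simp only [hdot]; exact patternVectors_orthonormal hx1 α β)
    -- `U` cancels its transpose, so these are again pairings of `T` with the original vectors.
    simp only [pairing_actOn, Matrix.mulVec_mulVec, hUU, Matrix.one_mulVec] at hb
    have hs := (hnorm.trans_lt h).trans_le (sum_sphere_le T x hx2)
    have hpos : (0 : ℝ) < (d + 1) ^ d := by positivity
    refine lt_of_lt_of_le ?_ ((energy_add_le T x).trans hb)
    rw [div_mul_eq_mul_div]
    gcongr
    rwa [div_lt_iff₀' hpos]

/-- Induction on `N`, which bounds the missing energy in units of one increment. -/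
theorem exists_concentrated_of_energy {ε : ℝ} (hε : 0 ≤ ε) (d N k₀ : ℕ) :
    ∃ K : ℕ, ∀ (n k : ℕ) (T : (Fin d → Fin n) → ℝ), IsSymmArray T → k ≤ n → k ≤ k₀ →
      normSq T - N * (ε / (d + 1) ^ d * normSq T) ≤ energy T k →
        ∃ U ∈ Matrix.orthogonalGroup (Fin n) ℝ, ∃ k' ≤ n, k' ≤ K ∧
          IsConcentrated ε d k' (linSubst U (ofArray T)) := by
  have base : ∀ (n k : ℕ) (T : (Fin d → Fin n) → ℝ), IsConcentrated ε d k (ofArray T) →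
      IsConcentrated ε d k (linSubst 1 (ofArray T)) := by
    intro n k T h
    convert h
    simp [linSubst, Matrix.one_apply]
  induction N generalizing k₀ with
  | zero =>
    refine ⟨k₀, fun n k T hT hkn hk h => ?_⟩
    by_cases hc : IsConcentrated ε d k (ofArray T)
    · exact ⟨1, one_mem _, k, hkn, hk, base n k T hc⟩
    -- No energy is missing, so a strict gain would exceed the norm.
    · obtain ⟨U, hU, k', -, -, hlt⟩ := exists_energy_increment T hε hT hc
      have h1 : 0 ≤ ε / (d + 1) ^ d * normSq T :=
        mul_nonneg (by positivity) (normSq_nonneg T)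
      have h2 := (energy_le_normSq (actOn T U) k').trans (normSq_actOn_le T hU)
      rw [Nat.cast_zero, zero_mul] at h
      linarith
  | succ N ih =>
    obtain ⟨K, hK⟩ := ih ((k₀ + 1) ^ d * d)
    refine ⟨max k₀ K, fun n k T hT hkn hk h => ?_⟩
    by_cases hc : IsConcentrated ε d k (ofArray T)
    · exact ⟨1, one_mem _, k, hkn, le_max_of_le_left hk, base n k T hc⟩
    · obtain ⟨U, hU, k', hk'n, hk', hlt⟩ := exists_energy_increment T hε hT hc
      obtain ⟨V, hV, l, hln, hl, hconc⟩ := hK n k' (actOn T U) (hT.actOn U) hk'n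
        (hk'.trans (by gcongr)) (by
          have h1 := normSq_actOn_le T hU
          have h2 := energy_nonneg (actOn T U) k'
          push_cast at h
          -- The new norm is only known not to exceed the old one, which helps when its factor 1 −
          -- Nδ is nonnegative, δ = ε/(d+1)^d; otherwise the required energy is at most 0.
          rcases le_total (N * (ε / (d + 1) ^ d)) 1 with h3 | h3
          · nlinarith [mul_le_mul_of_nonneg_left h1 (sub_nonneg.2 h3)]
          · nlinarith [mul_nonneg (sub_nonneg.2 h3) (normSq_nonneg (actOn T U))])
      refine ⟨U * V, mul_mem hU hV, l, hln, le_max_of_le_right hl, ?_⟩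
      rwa [← linSubst_linSubst, linSubst_ofArray]

end Concentration

end PolyConc

theorem mainTheorem4 :
    ∀ (ε : ℝ), 0 < ε → ∀ (d : ℕ), ∃ K : ℕ, ∀ (n : ℕ) (p : MvPolynomial (Fin n) ℝ),
      p.IsHomogeneous d →
        ∃ U ∈ Matrix.orthogonalGroup (Fin n) ℝ, ∃ k : ℕ, k ≤ n ∧ k ≤ K ∧
          PolyConc.IsConcentrated ε d k (PolyConc.linSubst U p) := by
  intro ε hε d
  have hδ : 0 < ε / ((d : ℝ) + 1) ^ d := by positivity
  obtain ⟨N, hN⟩ := exists_nat_ge (1 / (ε / ((d : ℝ) + 1) ^ d))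
  rw [div_le_iff₀ hδ] at hN
  obtain ⟨K, hK⟩ := PolyConc.exists_concentrated_of_energy hε.le d N 0
  refine ⟨K, fun n p hp => ?_⟩
  obtain ⟨T, hT, rfl⟩ := PolyConc.exists_symmArray hp
  -- Starting from k = 0 is allowed because `N` increments already cover the whole norm.
  refine hK n 0 T hT (Nat.zero_le n) le_rfl (le_trans ?_ (PolyConc.energy_nonneg T 0))
  nlinarith [PolyConc.normSq_nonneg T]
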